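/- A pseudo MV-algebra is an algebra $(M;\oplus,{}^-,{}^\sim,0,1)$ of type $(2,1,1,0,0)$ such that, with $y\odot x:=(x^-\oplus y^-)^\sim$ and with $\odot$ binding more strongly than $\oplus$, for all $x,y,z\in M$: (A1) $x\oplus(y\oplus z)=(x\oplus y)\oplus z$; (A2) $x\oplus0=0\oplus x=x$; (A3) $x\oplus1=1\oplus x=1$; (A4) $1^\sim=1^-=0$; (A5) $(x^-\oplus y^-)^\sim=(x^\sim\oplus y^\sim)^-$; (A6) $x\oplus x^\sim\odot y=y\oplus y^\sim\odot x=x\odot y^-\oplus y=y\odot x^-\oplus x$; (A7) $x\odot(x^-\oplus y)=(x\oplus y^\sim)\odot y$; (A8) $(x^-)^\sim=x$. The partial sum $x+y$ is defined if and only if $y\odot x=0$ (equivalently $x\le y^-$, i.e. $x^-\oplus y^-=1$), and then $x+y:=x\oplus y$. This partial addition is associative, so that finite partial sums $x_1+\cdots+x_n$ make sense. A Riesz space is a real vector space $R$ with a partial order that makes $(R,+)$ a lattice-ordered group and satisfies $af\ge0$ whenever $a\in\mathbb R$, $a\ge0$, and $f\in R$, $f\ge0$. A partially ordered set is Dedekind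 complete if each of its non-empty families that is bounded above has a supremum. Let $M$ be a pseudo MV-algebra and $R$ a Dedekind complete Riesz space. An $R$-measure on $M$ is a map $m:M\to R$ such that $m(x+y)=m(x)+m(y)$ whenever $x+y$ is defined in $M$, and $m(x)\ge0$ for all $x\in M$. An $R$-Jordan signed measure is a difference of two $R$-measures. Let $\mathcal J(M,R)$ be the set of all $R$-Jordan signed measures on $M$, a real vector space under pointwise operations, and for $m_1,m_2\in\mathcal J(M,R)$ put $m_1\le^+m_2$ if and only if $m_2-m_1$ is an $R$-measure. **Theorem.** With respect to the order $\le^+$ the following hold. (a) $\mathcal J(M,R)$ is a Dedekind complete lattice-ordered group. (b) If $\{m_i\}_{i\in I}$ is a non-empty family in $\mathcal J(M,R)$ that is bounded above, then the suprema $d(x)=\bigvee_i m_i(x)$, $x\in M$, exist in $R$, the supremum $\bigvee_i m_i$ exists in $\mathcal J(M,R)$, and for all $x\in M$ $$\Big(\bigvee_i m_i\Big)(x)=\bigvee\{d(x_1)+\cdots+d(x_n): x=x_1+\cdots+x_n,\ x_1,\ldots,x_n\in M,\ n\ge1\}.$$ (c) If $\{m_i\}_{i\in I}$ is a non-empty family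 in $\mathcal J(M,R)$ that is bounded below, then the infima $e(x)=\bigwedge_i m_i(x)$, $x\in M$, exist in $R$, the infimum $\bigwedge_i m_i$ exists in $\mathcal J(M,R)$, and for all $x\in M$ $$\Big(\bigwedge_i m_i\Big)(x)=\bigwedge\{e(x_1)+\cdots+e(x_n): x=x_1+\cdots+x_n,\ x_1,\ldots,x_n\in M,\ n\ge1\}.$$ (d) $\mathcal J(M,R)$ is a Dedekind complete Riesz space. -/

import Mathlib

universe u v w

/-- The operations of a pseudo MV-algebra: `oplus x y` is `x ⊕ y`, `lneg x` is `x⁻` and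
`rneg x` is `x^∼`. -/
class PseudoMVOps (M : Type u) extends Zero M, One M where
  oplus : M → M → M
  lneg : M → M
  rneg : M → M

namespace PseudoMV

/-- The derived product `y ⊙ x = (x⁻ ⊕ y⁻)^∼`. -/
def odot {M : Type u} [PseudoMVOps M] (y x : M) : M :=
  PseudoMVOps.rneg (PseudoMVOps.oplus (PseudoMVOps.lneg x) (PseudoMVOps.lneg y))

end PseudoMV

infixl:65 " ⊕ᴹ " => PseudoMVOps.oplus
infixl:70 " ⊙ᴹ " => PseudoMV.odot

open PseudoMVOps in
/-- Pseudo MV-algebras, a non-commutative generalization of MV-algebras. -/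
class PseudoMVAlgebra (M : Type u) extends PseudoMVOps M where
  oplus_assoc : ∀ x y z : M, x ⊕ᴹ (y ⊕ᴹ z) = x ⊕ᴹ y ⊕ᴹ z
  oplus_zero : ∀ x : M, x ⊕ᴹ 0 = x
  zero_oplus : ∀ x : M, 0 ⊕ᴹ x = x
  oplus_one : ∀ x : M, x ⊕ᴹ 1 = 1
  one_oplus : ∀ x : M, 1 ⊕ᴹ x = 1
  rneg_one : rneg (1 : M) = 0
  lneg_one : lneg (1 : M) = 0
  rneg_lneg_oplus_lneg : ∀ x y : M, rneg (lneg x ⊕ᴹ lneg y) = lneg (rneg x ⊕ᴹ rneg y)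
  sup_eq₁ : ∀ x y : M, x ⊕ᴹ rneg x ⊙ᴹ y = y ⊕ᴹ rneg y ⊙ᴹ x
  sup_eq₂ : ∀ x y : M, y ⊕ᴹ rneg y ⊙ᴹ x = x ⊙ᴹ lneg y ⊕ᴹ y
  sup_eq₃ : ∀ x y : M, x ⊙ᴹ lneg y ⊕ᴹ y = y ⊙ᴹ lneg x ⊕ᴹ x
  inf_eq : ∀ x y : M, x ⊙ᴹ (lneg x ⊕ᴹ y) = (x ⊕ᴹ rneg y) ⊙ᴹ y
  rneg_lneg : ∀ x : M, rneg (lneg x) = x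

namespace PseudoMV

section Measures

variable {M : Type u} [PseudoMVAlgebra M]

/-- The partial sum `x + y` is defined. Unfolding `⊙`, the condition `y ⊙ x = 0` reads
`(x⁻ ⊕ y⁻)^∼ = 0`, that is `x ≤ y⁻`; in an interval `[0, u]` of a lattice-ordered group it says
`x + y ≤ u`. When it holds, the value of the partial sum is `x ⊕ y`. -/
def AddDefined (x y : M) : Prop := y ⊙ᴹ x = 0

/-- `IsSumOf [x₁, …, xₙ] x` says that `n ≥ 1`, that the partial sum `x₁ + ⋯ + xₙ` is defined and
that it equals `x`. The partial addition is associative, so the bracketing is immaterial;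
here it is `x₁ + (x₂ + (⋯ + xₙ))`. -/
inductive IsSumOf : List M → M → Prop
  | single (x : M) : IsSumOf [x] x
  | cons (x : M) (l : List M) (s : M) : IsSumOf l s → AddDefined x s → IsSumOf (x :: l) (x ⊕ᴹ s)

/-- The set `{d(x₁) + ⋯ + d(xₙ) : x = x₁ + ⋯ + xₙ, n ≥ 1}`. -/
def decompSums {R : Type v} [AddCommGroup R] (d : M → R) (x : M) : Set R :=
  {r | ∃ l : List M, IsSumOf l x ∧ r = (l.map d).sum}

/-- `R`-signed measures: maps additive with respect to the partial addition. -/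
def IsSignedMeasure {R : Type v} [AddCommGroup R] (m : M → R) : Prop :=
  ∀ x y : M, AddDefined x y → m (x ⊕ᴹ y) = m x + m y

/-- `R`-measures: nonnegative `R`-signed measures. -/
structure IsMeasure {R : Type v} [AddCommGroup R] [PartialOrder R] (m : M → R) : Prop where
  isSignedMeasure : IsSignedMeasure m
  nonneg : ∀ x, 0 ≤ m x

/-- `R`-Jordan signed measures: differences of two `R`-measures. -/
def IsJordanSignedMeasure {R : Type v} [AddCommGroup R] [PartialOrder R] (m : M → R) : Prop :=
  ∃ m₁ m₂ : M → R, IsMeasure m₁ ∧ IsMeasure m₂ ∧ m = m₁ - m₂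

section Closure

variable {R : Type v} [AddCommGroup R] [Lattice R] [IsOrderedAddMonoid R]

theorem IsMeasure.zero : IsMeasure (0 : M → R) :=
  ⟨fun _ _ _ => by simp, fun _ => le_rfl⟩

theorem IsMeasure.add {m₁ m₂ : M → R} (h₁ : IsMeasure m₁) (h₂ : IsMeasure m₂) :
    IsMeasure (m₁ + m₂) :=
  ⟨fun x y h => by
    simp only [Pi.add_apply, h₁.isSignedMeasure x y h, h₂.isSignedMeasure x y h]; abel,
   fun x => add_nonneg (h₁.nonneg x) (h₂.nonneg x)⟩

theorem IsMeasure.smul [Module ℝ R] [IsOrderedModule ℝ R] {m : M → R} (h : IsMeasure m)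
    {a : ℝ} (ha : 0 ≤ a) : IsMeasure (a • m) :=
  ⟨fun x y hxy => by simp only [Pi.smul_apply, h.isSignedMeasure x y hxy, smul_add],
   fun x => smul_nonneg ha (h.nonneg x)⟩

end Closure

variable (M) in
/-- The real vector space of `R`-Jordan signed measures, with pointwise operations. -/
def jordanSubmodule (R : Type v) [AddCommGroup R] [Lattice R] [IsOrderedAddMonoid R]
    [Module ℝ R] [IsOrderedModule ℝ R] : Submodule ℝ (M → R) where
  carrier := {m | IsJordanSignedMeasure m}
  zero_mem' := ⟨0, 0, IsMeasure.zero, IsMeasure.zero, by simp⟩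
  add_mem' := by
    rintro _ _ ⟨p, q, hp, hq, rfl⟩ ⟨p', q', hp', hq', rfl⟩
    exact ⟨p + p', q + q', hp.add hp', hq.add hq', by abel⟩
  smul_mem' := by
    rintro a _ ⟨p, q, hp, hq, rfl⟩
    rcases le_total 0 a with ha | ha
    · exact ⟨a • p, a • q, hp.smul ha, hq.smul ha, smul_sub a p q⟩
    · refine ⟨(-a) • q, (-a) • p, hq.smul (neg_nonneg.2 ha), hp.smul (neg_nonneg.2 ha), ?_⟩
      rw [smul_sub, neg_smul, neg_smul]; abel

end Measures

/-- The type `𝒥(M, R)` of `R`-Jordan signed measures on `M`. Its order is not the one inherited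
from a function space but the one given by the cone of `R`-measures, see below. -/
def JordanMeasure (M : Type u) [PseudoMVAlgebra M] (R : Type v) [AddCommGroup R] [Lattice R]
    [IsOrderedAddMonoid R] [Module ℝ R] [IsOrderedModule ℝ R] : Type (max u v) :=
  ↥(jordanSubmodule M R)

namespace JordanMeasure

variable {M : Type u} [PseudoMVAlgebra M] {R : Type v} [AddCommGroup R] [Lattice R]
  [IsOrderedAddMonoid R] [Module ℝ R] [IsOrderedModule ℝ R]

instance : AddCommGroup (JordanMeasure M R) := inferInstanceAs (AddCommGroup ↥(jordanSubmodule M R))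

instance : Module ℝ (JordanMeasure M R) := inferInstanceAs (Module ℝ ↥(jordanSubmodule M R))

instance : CoeFun (JordanMeasure M R) (fun _ => M → R) := ⟨fun m => m.1⟩

/-- The order `m₁ ≤⁺ m₂`: the difference `m₂ - m₁` is an `R`-measure. -/
instance : LE (JordanMeasure M R) := ⟨fun m₁ m₂ => IsMeasure (m₂ - m₁ : JordanMeasure M R).1⟩

theorem le_def (m₁ m₂ : JordanMeasure M R) :
    m₁ ≤ m₂ ↔ IsMeasure (m₂ - m₁ : JordanMeasure M R).1 := Iff.rfl

theorem isSignedMeasure (m : JordanMeasure M R) : IsSignedMeasure m.1 := by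
  obtain ⟨p, q, hp, hq, h⟩ := m.2
  intro x y hxy
  rw [h]
  simp only [Pi.sub_apply, hp.isSignedMeasure x y hxy, hq.isSignedMeasure x y hxy]
  abel

theorem le_iff (m₁ m₂ : JordanMeasure M R) : m₁ ≤ m₂ ↔ ∀ x, m₁ x ≤ m₂ x :=
  ⟨fun h x => sub_nonneg.1 (h.nonneg x),
   fun h => ⟨(m₂ - m₁).isSignedMeasure, fun x => sub_nonneg.2 (h x)⟩⟩

instance : PartialOrder (JordanMeasure M R) where
  le_refl m := (le_iff m m).2 fun _ => le_rfl
  le_trans a b c hab hbc := (le_iff a c).2 fun x => ((le_iff a b).1 hab x).trans ((le_iff b c).1 hbc x)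
  le_antisymm a b hab hba :=
    Subtype.ext (funext fun x => le_antisymm ((le_iff a b).1 hab x) ((le_iff b a).1 hba x))

/-- The positive cone of `𝒥(M, R)` is the set of `R`-measures. -/
theorem nonneg_iff (m : JordanMeasure M R) : 0 ≤ m ↔ IsMeasure m.1 := by
  rw [le_def, sub_zero]

end JordanMeasure

/-- Abelian lattice-ordered groups, as a property of an abelian group with a partial order. -/
structure IsLatticeOrderedGroup (E : Type w) [AddCommGroup E] [PartialOrder E] : Prop where
  add_le_add : ∀ a b c d : E, a ≤ b → c + a + d ≤ c + b + d
  exists_sup : ∀ a b : E, ∃ c, IsLUB {a, b} c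
  exists_inf : ∀ a b : E, ∃ c, IsGLB {a, b} c

/-- Riesz spaces, as a property of a real vector space with a partial order. -/
structure IsRieszSpace (E : Type w) [AddCommGroup E] [Module ℝ E] [PartialOrder E] : Prop where
  isLatticeOrderedGroup : IsLatticeOrderedGroup E
  smul_nonneg : ∀ (a : ℝ) (f : E), 0 ≤ a → 0 ≤ f → 0 ≤ a • f

/-- Dedekind completeness: every non-empty family that is bounded above has a supremum. -/
def DedekindComplete (E : Type w) [PartialOrder E] : Prop :=
  ∀ s : Set E, s.Nonempty → BddAbove s → ∃ a, IsLUB s a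

end PseudoMV

/-!
Everything rests on the Riesz refinement property of the partial addition of a pseudo MV-algebra
(`AddDefined.refinement`): two decompositions `a₁ + a₂ = b₁ + b₂` have a common refinement. It is
derived from the axioms, without representing `M` as an interval of a lattice-ordered group. With
`c = a₁ ∧ b₁`, `a₁ = c + p` and `b₁ = c + q`, the remainders `p` and `q` are disjoint, and disjoint
elements satisfy `p + q = q + p = p ∨ q` (`addDefined_of_inf_eq_zero`, `oplus_eq_sup_of_inf_eq_zero`).
Cancelling `c` gives `p + a₂ = q + b₂`, an element above `p ∨ q`; if `g` is its difference with
`p ∨ q`, then `a₂ = q + g` and `b₂ = p + g`.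

Let now `m i` be a family bounded above by `n` in `𝒥(M, R)`, and put `d x = ⋁ i, m i x`. The map
`d` is subadditive. The sums of `d` over the decompositions of `x` are bounded by `n x`, because
`d ≤ n` and `n` is additive; let `s x` be their supremum. Concatenating decompositions
(`IsSumOf.append`) shows `s x + s y ≤ s (x + y)`. Refining a decomposition of `x + y` along `x + y`
(`IsSumOf.exists_refinement`) and using subadditivity of `d` shows the opposite inequality. So `s`
is additive; it dominates every `m i`, hence is a Jordan signed measure, and it lies below every
upper bound of the family. Infima follow by the symmetry `m ↦ -m`, and a pair of Jordan signed
measures `p - q`, `p' - q'` is always bounded above, by `p + p'`.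
-/

namespace PseudoMV

open PseudoMVOps PseudoMVAlgebra

/-! ### Arithmetic and order of a pseudo MV-algebra -/

section Order

variable {M : Type u} [PseudoMVAlgebra M]

theorem lneg_rneg (x : M) : lneg (rneg x) = x := by
  have h := rneg_lneg_oplus_lneg x 1
  rw [lneg_one, rneg_one, oplus_zero, oplus_zero, rneg_lneg] at h
  exact h.symm

theorem lneg_zero : lneg (0 : M) = 1 := by
  rw [← rneg_one, lneg_rneg]

theorem lneg_odot (x y : M) : lneg (x ⊙ᴹ y) = lneg y ⊕ᴹ lneg x := by
  rw [odot, lneg_rneg]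

theorem rneg_odot (x y : M) : rneg (x ⊙ᴹ y) = rneg y ⊕ᴹ rneg x := by
  rw [odot, rneg_lneg_oplus_lneg, rneg_lneg]

theorem lneg_oplus (x y : M) : lneg (x ⊕ᴹ y) = lneg y ⊙ᴹ lneg x := by
  rw [← lneg_rneg (lneg y ⊙ᴹ lneg x), rneg_odot, rneg_lneg, rneg_lneg]

theorem rneg_oplus (x y : M) : rneg (x ⊕ᴹ y) = rneg y ⊙ᴹ rneg x := by
  rw [odot, lneg_rneg, lneg_rneg]

theorem odot_one (x : M) : x ⊙ᴹ 1 = x := by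
  rw [odot, lneg_one, zero_oplus, rneg_lneg]

theorem oplus_rneg (x : M) : x ⊕ᴹ rneg x = 1 := by
  have h := sup_eq₁ x 1
  rwa [odot_one, one_oplus] at h

theorem lneg_oplus_self (x : M) : lneg x ⊕ᴹ x = 1 := by
  have h := oplus_rneg (lneg x)
  rwa [rneg_lneg] at h

/-- The natural order of a pseudo MV-algebra: `x ≤ y` if and only if `x⁻ ⊕ y = 1`. -/
instance : PartialOrder M where
  le x y := lneg x ⊕ᴹ y = 1
  le_refl x := lneg_oplus_self x
  le_trans x y z hxy hyz := by
    have key : ∀ a b : M, lneg a ⊕ᴹ b = 1 → a ⊕ᴹ rneg a ⊙ᴹ b = b := fun a b h => by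
      have h0 : rneg b ⊙ᴹ a = 0 := by rw [odot, lneg_rneg, h, rneg_one]
      rw [sup_eq₁, h0, oplus_zero]
    rw [← key y z hyz, ← key x y hxy, ← oplus_assoc, oplus_assoc (lneg x), lneg_oplus_self,
      one_oplus]
  le_antisymm x y hxy hyx := by
    have key : ∀ a b : M, lneg a ⊕ᴹ b = 1 → b ⊕ᴹ rneg b ⊙ᴹ a = b := fun a b h => by
      have h0 : rneg b ⊙ᴹ a = 0 := by rw [odot, lneg_rneg, h, rneg_one]
      rw [h0, oplus_zero]
    rw [← key x y hxy, ← sup_eq₁, key y x hyx]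

theorem le_iff_lneg_oplus {x y : M} : x ≤ y ↔ lneg x ⊕ᴹ y = 1 := Iff.rfl

theorem le_oplus_right (x w : M) : x ≤ x ⊕ᴹ w := by
  rw [le_iff_lneg_oplus, oplus_assoc, lneg_oplus_self, one_oplus]

theorem oplus_rneg_odot_of_le {x y : M} (h : x ≤ y) : x ⊕ᴹ rneg x ⊙ᴹ y = y := by
  have h0 : rneg y ⊙ᴹ x = 0 := by rw [odot, lneg_rneg, le_iff_lneg_oplus.1 h, rneg_one]
  rw [sup_eq₁, h0, oplus_zero]

theorem odot_lneg_oplus_of_le {x y : M} (h : x ≤ y) : y ⊙ᴹ lneg x ⊕ᴹ x = y := by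
  rw [← sup_eq₂, oplus_rneg_odot_of_le h]

theorem le_iff_oplus_rneg {x y : M} : x ≤ y ↔ y ⊕ᴹ rneg x = 1 := by
  constructor
  · intro h
    rw [← odot_lneg_oplus_of_le h, ← oplus_assoc, oplus_rneg, oplus_one]
  · intro h
    have h0 : x ⊙ᴹ lneg y = 0 := by
      rw [← lneg_rneg (x ⊙ᴹ lneg y), rneg_odot, rneg_lneg, h, lneg_one]
    have h1 : x ⊕ᴹ rneg x ⊙ᴹ y = y := by
      rw [sup_eq₁, sup_eq₂, h0, zero_oplus]
    exact h1 ▸ le_oplus_right x _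

theorem le_oplus_left (x w : M) : x ≤ w ⊕ᴹ x := by
  rw [le_iff_oplus_rneg, ← oplus_assoc, oplus_rneg, oplus_one]

theorem zero_le (x : M) : 0 ≤ x := by
  simpa only [zero_oplus] using le_oplus_right 0 x

theorem oplus_le_oplus_left {x y : M} (h : x ≤ y) (a : M) : a ⊕ᴹ x ≤ a ⊕ᴹ y := by
  rw [← oplus_rneg_odot_of_le h, oplus_assoc]
  exact le_oplus_right _ _

theorem oplus_le_oplus_right {x y : M} (h : x ≤ y) (a : M) : x ⊕ᴹ a ≤ y ⊕ᴹ a := by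
  rw [← odot_lneg_oplus_of_le h, ← oplus_assoc]
  exact le_oplus_left _ _

theorem lneg_le_lneg {x y : M} (h : x ≤ y) : lneg y ≤ lneg x := by
  rwa [le_iff_oplus_rneg, rneg_lneg]

theorem rneg_le_rneg {x y : M} (h : x ≤ y) : rneg y ≤ rneg x := by
  rw [le_iff_lneg_oplus, lneg_rneg]
  exact le_iff_oplus_rneg.1 h

theorem odot_le_odot_left {x y : M} (h : x ≤ y) (a : M) : a ⊙ᴹ x ≤ a ⊙ᴹ y :=
  rneg_le_rneg (oplus_le_oplus_right (lneg_le_lneg h) _)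

theorem odot_le_left (x y : M) : x ⊙ᴹ y ≤ x := by
  have h := rneg_le_rneg (le_oplus_left (lneg x) (lneg y))
  rwa [rneg_lneg] at h

theorem odot_le_right (x y : M) : x ⊙ᴹ y ≤ y := by
  have h := rneg_le_rneg (le_oplus_right (lneg y) (lneg x))
  rwa [rneg_lneg] at h

theorem lneg_odot_lneg_oplus (x y : M) :
    lneg (x ⊙ᴹ (lneg x ⊕ᴹ y)) = lneg x ⊕ᴹ rneg (lneg x) ⊙ᴹ lneg y := by
  rw [lneg_odot, lneg_oplus, sup_eq₂]

/-- The lattice structure of a pseudo MV-algebra: `x ∨ y = x ⊕ x^∼ ⊙ y` and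
`x ∧ y = x ⊙ (x⁻ ⊕ y)`. -/
instance : Lattice M where
  sup x y := x ⊕ᴹ rneg x ⊙ᴹ y
  le_sup_left x y := le_oplus_right _ _
  le_sup_right x y := (le_oplus_right y _).trans (sup_eq₁ x y).ge
  sup_le x y z hxz hyz :=
    (oplus_le_oplus_left (odot_le_odot_left hyz _) _).trans (oplus_rneg_odot_of_le hxz).le
  inf x y := x ⊙ᴹ (lneg x ⊕ᴹ y)
  inf_le_left x y := odot_le_left _ _
  inf_le_right x y := by
    rw [inf_eq]
    exact odot_le_right _ _
  le_inf x y z hxy hxz := by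
    -- the negation turns the claim into the universal property of the supremum `y⁻ ∨ z⁻`
    rw [← rneg_lneg x, ← rneg_lneg (y ⊙ᴹ (lneg y ⊕ᴹ z)), lneg_odot_lneg_oplus]
    exact rneg_le_rneg ((oplus_le_oplus_left (odot_le_odot_left (lneg_le_lneg hxz) _) _).trans
      (oplus_rneg_odot_of_le (lneg_le_lneg hxy)).le)

theorem sup_def (x y : M) : x ⊔ y = x ⊕ᴹ rneg x ⊙ᴹ y := rfl

theorem inf_def (x y : M) : x ⊓ y = x ⊙ᴹ (lneg x ⊕ᴹ y) := rfl

theorem le_oplus_iff {a w z : M} : w ≤ a ⊕ᴹ z ↔ rneg a ⊙ᴹ w ≤ z := by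
  constructor
  · intro h
    have h1 : rneg a ⊙ᴹ (a ⊕ᴹ z) = rneg a ⊓ z := by rw [inf_def, lneg_rneg]
    exact (odot_le_odot_left h _).trans (h1.trans_le inf_le_right)
  · intro h
    exact (le_sup_right : w ≤ a ⊔ w).trans (oplus_le_oplus_left h a)

theorem oplus_inf (a x y : M) : a ⊕ᴹ (x ⊓ y) = (a ⊕ᴹ x) ⊓ (a ⊕ᴹ y) :=
  le_antisymm
    (le_inf (oplus_le_oplus_left inf_le_left a) (oplus_le_oplus_left inf_le_right a))
    (le_oplus_iff.2 (le_inf (le_oplus_iff.1 inf_le_left) (le_oplus_iff.1 inf_le_right)))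

end Order

/-! ### The partial addition and its refinement property -/

section PartialAddition

variable {M : Type u} [PseudoMVAlgebra M]

theorem addDefined_iff_le_lneg {x y : M} : AddDefined x y ↔ x ≤ lneg y := by
  rw [AddDefined, odot, le_iff_lneg_oplus]
  exact ⟨fun h => by rw [← lneg_rneg (lneg x ⊕ᴹ lneg y), h, lneg_zero],
    fun h => by rw [h, rneg_one]⟩

theorem addDefined_iff_le_rneg {x y : M} : AddDefined x y ↔ y ≤ rneg x := by
  rw [addDefined_iff_le_lneg]
  exact ⟨fun h => by simpa only [rneg_lneg] using rneg_le_rneg h,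
    fun h => by simpa only [lneg_rneg] using lneg_le_lneg h⟩

/-- Associativity of the partial addition: if `(x + y) + z` is defined, then so is `x + (y + z)`. -/
theorem AddDefined.assoc_right {x y z : M} (hxy : AddDefined x y) (h : AddDefined (x ⊕ᴹ y) z) :
    AddDefined y z ∧ AddDefined x (y ⊕ᴹ z) := by
  refine ⟨addDefined_iff_le_lneg.2
    ((le_oplus_left y x).trans (addDefined_iff_le_lneg.1 h)), addDefined_iff_le_rneg.2 ?_⟩
  have hz := addDefined_iff_le_rneg.1 h
  rw [rneg_oplus] at hz
  exact (oplus_le_oplus_left hz y).trans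
    (oplus_rneg_odot_of_le (addDefined_iff_le_rneg.1 hxy)).le

theorem AddDefined.left_cancel {x y z : M} (hy : AddDefined x y) (hz : AddDefined x z)
    (h : x ⊕ᴹ y = x ⊕ᴹ z) : y = z := by
  -- `x^∼ ⊙ (x ⊕ w)` is the infimum of `x^∼` and `w`
  have key : ∀ w : M, AddDefined x w → rneg x ⊙ᴹ (x ⊕ᴹ w) = w := fun w hw => by
    have h1 : rneg x ⊙ᴹ (x ⊕ᴹ w) = rneg x ⊓ w := by rw [inf_def, lneg_rneg]
    rw [h1, inf_eq_right.2 (addDefined_iff_le_rneg.1 hw)]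
  rw [← key y hy, h, key z hz]

theorem exists_add_of_le {x y : M} (h : x ≤ y) : ∃ z, AddDefined x z ∧ x ⊕ᴹ z = y :=
  ⟨rneg x ⊙ᴹ y, addDefined_iff_le_rneg.2 (odot_le_left _ _), oplus_rneg_odot_of_le h⟩

theorem rneg_odot_of_inf_eq_zero {p q : M} (h : p ⊓ q = 0) : rneg p ⊙ᴹ q = q := by
  have h1 : lneg q ⊕ᴹ p = lneg q := by
    have h2 : lneg q ⊕ᴹ p ≤ lneg q ⊕ᴹ q := by
      rw [lneg_oplus_self, le_iff_lneg_oplus, oplus_one]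
    rw [← inf_eq_left.2 h2, ← oplus_inf, h, oplus_zero]
  rw [odot, lneg_rneg, h1, rneg_lneg]

theorem addDefined_of_inf_eq_zero {p q : M} (h : p ⊓ q = 0) : AddDefined p q := by
  rw [addDefined_iff_le_rneg, ← rneg_odot_of_inf_eq_zero h]
  exact odot_le_left _ _

theorem oplus_eq_sup_of_inf_eq_zero {p q : M} (h : p ⊓ q = 0) : p ⊕ᴹ q = p ⊔ q := by
  rw [sup_def, rneg_odot_of_inf_eq_zero h]

/-- The remainders of `a` and `b` over `a ∧ b` are disjoint. -/
theorem inf_eq_zero_of_oplus_eq {a b p q : M} (hp : AddDefined (a ⊓ b) p)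
    (hpa : (a ⊓ b) ⊕ᴹ p = a) (hqb : (a ⊓ b) ⊕ᴹ q = b) : p ⊓ q = 0 := by
  have hd : AddDefined (a ⊓ b) (p ⊓ q) :=
    addDefined_iff_le_rneg.2 (inf_le_left.trans (addDefined_iff_le_rneg.1 hp))
  have hle : (a ⊓ b) ⊕ᴹ (p ⊓ q) ≤ a ⊓ b :=
    le_inf ((oplus_le_oplus_left inf_le_left _).trans hpa.le)
      ((oplus_le_oplus_left inf_le_right _).trans hqb.le)
  refine hd.left_cancel (addDefined_iff_le_rneg.2 (zero_le _)) ?_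
  rw [oplus_zero]
  exact le_antisymm hle (le_oplus_right _ _)

/-- Riesz refinement: if `a₁ + a₂ = b₁ + b₂`, then `a₁ = c + p`, `a₂ = q + g`, `b₁ = c + q` and
`b₂ = p + g` for some `c`, `p`, `q`, `g`. -/
theorem AddDefined.refinement {a₁ a₂ b₁ b₂ : M} (ha : AddDefined a₁ a₂) (hb : AddDefined b₁ b₂)
    (h : a₁ ⊕ᴹ a₂ = b₁ ⊕ᴹ b₂) :
    ∃ c p q g : M, (AddDefined c p ∧ c ⊕ᴹ p = a₁) ∧ (AddDefined q g ∧ q ⊕ᴹ g = a₂) ∧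
      (AddDefined c q ∧ c ⊕ᴹ q = b₁) ∧ (AddDefined p g ∧ p ⊕ᴹ g = b₂) := by
  obtain ⟨p, hp, hpa⟩ := exists_add_of_le (inf_le_left : a₁ ⊓ b₁ ≤ a₁)
  obtain ⟨q, hq, hqb⟩ := exists_add_of_le (inf_le_right : a₁ ⊓ b₁ ≤ b₁)
  have hpq : p ⊓ q = 0 := inf_eq_zero_of_oplus_eq hp hpa hqb
  have hqp : q ⊓ p = 0 := by rw [inf_comm, hpq]
  obtain ⟨hpa₂, hcp⟩ := hp.assoc_right (hpa.symm ▸ ha : AddDefined ((a₁ ⊓ b₁) ⊕ᴹ p) a₂)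
  obtain ⟨hqb₂, hcq⟩ := hq.assoc_right (hqb.symm ▸ hb : AddDefined ((a₁ ⊓ b₁) ⊕ᴹ q) b₂)
  have hf : p ⊕ᴹ a₂ = q ⊕ᴹ b₂ := by
    refine hcp.left_cancel hcq ?_
    rw [oplus_assoc, oplus_assoc, hpa, hqb, h]
  have hle : p ⊔ q ≤ p ⊕ᴹ a₂ := sup_le (le_oplus_right _ _) (hf ▸ le_oplus_right _ _)
  obtain ⟨g, hg, hgf⟩ := exists_add_of_le hle
  have hpg := hg
  rw [← oplus_eq_sup_of_inf_eq_zero hpq] at hg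
  rw [sup_comm, ← oplus_eq_sup_of_inf_eq_zero hqp] at hpg
  obtain ⟨hqg, hpqg⟩ := (addDefined_of_inf_eq_zero hpq).assoc_right hg
  obtain ⟨hpg', hqpg⟩ := (addDefined_of_inf_eq_zero hqp).assoc_right hpg
  refine ⟨a₁ ⊓ b₁, p, q, g, ⟨hp, hpa⟩, ⟨hqg, hpqg.left_cancel hpa₂ ?_⟩, ⟨hq, hqb⟩,
    ⟨hpg', hqpg.left_cancel hqb₂ ?_⟩⟩
  · rw [oplus_assoc, oplus_eq_sup_of_inf_eq_zero hpq, hgf]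
  · rw [oplus_assoc, oplus_eq_sup_of_inf_eq_zero hqp, sup_comm, hgf, hf]

theorem IsSumOf.append {l l' : List M} {x y : M} (hl : IsSumOf l x) (hl' : IsSumOf l' y)
    (h : AddDefined x y) : IsSumOf (l ++ l') (x ⊕ᴹ y) := by
  induction hl with
  | single x => exact .cons x l' y hl' h
  | cons x l s _ hxs ih =>
    obtain ⟨h1, h2⟩ := hxs.assoc_right h
    rw [← oplus_assoc]
    exact .cons x (l ++ l') _ (ih h1) h2

end PartialAddition

/-! ### Sums over decompositions -/

theorem range_neg_apply {ι G : Type*} [InvolutiveNeg G] (f : ι → G) :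
    Set.range (fun i => -f i) = -Set.range f := by
  rw [← Set.image_neg_eq_neg, ← Set.range_comp, Function.comp_def]

theorem sum_map_neg {α : Type*} {G : Type*} [AddCommGroup G] (f : α → G) (l : List α) : (l.map (-f)).sum = -(l.map f).sum := by
  induction l with
  | nil => simp
  | cons a l ih => rw [List.map_cons, List.sum_cons, ih, List.map_cons, List.sum_cons, neg_add,
      Pi.neg_apply]

section Decompositions

variable {M : Type u} [PseudoMVAlgebra M] {R : Type v} [AddCommGroup R]

theorem IsSignedMeasure.sum_map_eq {m : M → R} (hm : IsSignedMeasure m) {l : List M} {x : M}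
    (hl : IsSumOf l x) : (l.map m).sum = m x := by
  induction hl with
  | single x => simp
  | cons x l s _ hxs ih => rw [List.map_cons, List.sum_cons, ih, hm x s hxs]

theorem decompSums_neg (f : M → R) (x : M) : decompSums (-f) x = -decompSums f x := by
  ext r
  simp only [decompSums, Set.mem_neg, Set.mem_ofPred_eq, sum_map_neg, neg_eq_iff_eq_neg]

theorem self_mem_decompSums (d : M → R) (x : M) : d x ∈ decompSums d x :=
  ⟨[x], .single x, by simp⟩

variable [PartialOrder R] [IsOrderedAddMonoid R]

/-- A decomposition of `x + y` can be refined to one made of a decomposition of `x` and a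
decomposition of `y`; the refinement does not decrease the sum of a subadditive function. -/
theorem IsSumOf.exists_refinement {d : M → R}
    (hd : ∀ x y : M, AddDefined x y → d (x ⊕ᴹ y) ≤ d x + d y) {l : List M} {z : M}
    (hl : IsSumOf l z) : ∀ {x y : M}, AddDefined x y → x ⊕ᴹ y = z →
      ∃ l₁ l₂ : List M, IsSumOf l₁ x ∧ IsSumOf l₂ y ∧
        (l.map d).sum ≤ (l₁.map d).sum + (l₂.map d).sum := by
  induction hl with
  | single z =>
    rintro x y hxy rfl
    exact ⟨[x], [y], .single x, .single y, by simpa using hd x y hxy⟩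
  | cons a l s _ has ih =>
    intro x y hxy hz
    obtain ⟨c, p, q, g, ⟨hcp, rfl⟩, ⟨hqg, rfl⟩, ⟨hcq, rfl⟩, ⟨hpg, rfl⟩⟩ :=
      has.refinement hxy hz.symm
    obtain ⟨l₁, l₂, h₁, h₂, hle⟩ := ih hqg rfl
    refine ⟨c :: l₁, p :: l₂, .cons c l₁ q h₁ hcq, .cons p l₂ g h₂ hpg, ?_⟩
    simp only [List.map_cons, List.sum_cons]
    calc d (c ⊕ᴹ p) + (l.map d).sum
        ≤ (d c + d p) + ((l₁.map d).sum + (l₂.map d).sum) := add_le_add (hd c p hcp) hle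
      _ = _ := by abel

theorem sum_map_le_of_isSumOf {d n : M → R} (hn : IsSignedMeasure n) (h : ∀ x, d x ≤ n x)
    {l : List M} {x : M} (hl : IsSumOf l x) : (l.map d).sum ≤ n x := by
  rw [← hn.sum_map_eq hl]
  exact List.sum_le_sum fun a _ => h a

/-- The suprema of the decomposition sums of a subadditive function form a signed measure. -/
theorem isSignedMeasure_of_isLUB_decompSums {d s : M → R}
    (hd : ∀ x y : M, AddDefined x y → d (x ⊕ᴹ y) ≤ d x + d y)
    (hs : ∀ x, IsLUB (decompSums d x) (s x)) : IsSignedMeasure s := by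
  intro x y hxy
  refine le_antisymm ((hs _).2 ?_) ?_
  · rintro _ ⟨l, hl, rfl⟩
    obtain ⟨l₁, l₂, h₁, h₂, hle⟩ := hl.exists_refinement hd hxy rfl
    exact hle.trans (add_le_add ((hs x).1 ⟨l₁, h₁, rfl⟩) ((hs y).1 ⟨l₂, h₂, rfl⟩))
  · rw [← le_sub_iff_add_le]
    refine (hs x).2 ?_
    rintro _ ⟨l₁, h₁, rfl⟩
    rw [le_sub_comm]
    refine (hs y).2 ?_
    rintro _ ⟨l₂, h₂, rfl⟩
    rw [le_sub_iff_add_le']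
    exact (hs _).1 ⟨l₁ ++ l₂, h₁.append h₂ hxy, by rw [List.map_append, List.sum_append]⟩

end Decompositions

/-! ### The lattice of Jordan signed measures -/

namespace JordanMeasure

variable {M : Type u} [PseudoMVAlgebra M] {R : Type v} [AddCommGroup R] [Lattice R]
  [IsOrderedAddMonoid R] [Module ℝ R] [IsOrderedModule ℝ R]

instance : IsOrderedAddMonoid (JordanMeasure M R) where
  add_le_add_left a b h c := (le_iff _ _).2 fun x => add_le_add_left ((le_iff a b).1 h x) (c x)

theorem exists_sup_formula (hR : DedekindComplete R) {I : Type w} [Nonempty I]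
    (m : I → JordanMeasure M R) (hm : BddAbove (Set.range m)) :
    ∃ d : M → R, (∀ x : M, IsLUB (Set.range fun i => m i x) (d x)) ∧
      ∃ s : JordanMeasure M R, IsLUB (Set.range m) s ∧
        ∀ x : M, IsLUB (decompSums d x) (s x) := by
  obtain ⟨n, hn⟩ := hm
  have hdex : ∀ x : M, ∃ r, IsLUB (Set.range fun i => m i x) r := fun x => by
    refine hR _ (Set.range_nonempty _) ⟨n x, ?_⟩
    rintro _ ⟨i, rfl⟩
    exact (le_iff _ _).1 (hn ⟨i, rfl⟩) x
  choose d hd using hdex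
  have hdle : ∀ n' ∈ upperBounds (Set.range m), ∀ x, d x ≤ n' x := by
    intro n' hn' x
    refine (hd x).2 ?_
    rintro _ ⟨i, rfl⟩
    exact (le_iff _ _).1 (hn' ⟨i, rfl⟩) x
  have hsub : ∀ x y : M, AddDefined x y → d (x ⊕ᴹ y) ≤ d x + d y := by
    intro x y hxy
    refine (hd _).2 ?_
    rintro _ ⟨i, rfl⟩
    exact ((m i).isSignedMeasure x y hxy).trans_le
      (add_le_add ((hd x).1 ⟨i, rfl⟩) ((hd y).1 ⟨i, rfl⟩))
  have hsex : ∀ x : M, ∃ r, IsLUB (decompSums d x) r := fun x => by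
    refine hR _ ⟨_, self_mem_decompSums d x⟩ ⟨n x, ?_⟩
    rintro _ ⟨l, hl, rfl⟩
    exact sum_map_le_of_isSumOf n.isSignedMeasure (hdle n hn) hl
  choose s hs using hsex
  have hsm : IsSignedMeasure s := isSignedMeasure_of_isLUB_decompSums hsub hs
  have hms : ∀ i x, m i x ≤ s x := fun i x =>
    ((hd x).1 ⟨i, rfl⟩).trans ((hs x).1 (self_mem_decompSums d x))
  -- `s` exceeds a member `p - q` of the family by a measure `s - (p - q)`, so that
  -- `s = (s - (p - q) + p) - q` is a Jordan signed measure
  have hsJ : IsJordanSignedMeasure s := by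
    obtain ⟨i⟩ := ‹Nonempty I›
    obtain ⟨p, q, hp, hq, hpq⟩ := (m i).2
    refine ⟨(s - (m i).1) + p, q, IsMeasure.add ⟨?_, fun x => sub_nonneg.2 (hms i x)⟩ hp, hq, ?_⟩
    · intro x y hxy
      simp only [Pi.sub_apply, hsm x y hxy, (m i).isSignedMeasure x y hxy]
      abel
    · rw [hpq]
      abel
  refine ⟨d, hd, ⟨s, hsJ⟩, ⟨?_, fun n' hn' => (le_iff _ _).2 fun x => (hs x).2 ?_⟩, hs⟩
  · rintro _ ⟨i, rfl⟩
    exact (le_iff _ _).2 (hms i)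
  · rintro _ ⟨l, hl, rfl⟩
    exact sum_map_le_of_isSumOf n'.isSignedMeasure (hdle n' hn') hl

/-- The infimum formula, obtained from the supremum formula for the family of negatives. -/
theorem exists_inf_formula (hR : DedekindComplete R) {I : Type w} [Nonempty I]
    (m : I → JordanMeasure M R) (hm : BddBelow (Set.range m)) :
    ∃ e : M → R, (∀ x : M, IsGLB (Set.range fun i => m i x) (e x)) ∧
      ∃ s : JordanMeasure M R, IsGLB (Set.range m) s ∧
        ∀ x : M, IsGLB (decompSums e x) (s x) := by
  obtain ⟨d, hd, s, hs, hsd⟩ := exists_sup_formula hR (fun i => -m i)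
    (by rw [range_neg_apply]; exact hm.neg)
  refine ⟨-d, fun x => ?_, -s, ?_, fun x => ?_⟩
  · have h := hd x
    change IsLUB (Set.range fun i => -(m i x)) (d x) at h
    rw [range_neg_apply] at h
    exact isLUB_neg.1 h
  · rw [range_neg_apply] at hs
    exact isLUB_neg.1 hs
  · have hval : (-s : JordanMeasure M R).1 x = -(s x) := rfl
    rw [decompSums_neg, hval, isGLB_neg, neg_neg]
    exact hsd x

theorem exists_isLUB_pair (hR : DedekindComplete R) (a b : JordanMeasure M R) :
    ∃ c, IsLUB {a, b} c := by
  obtain ⟨p, q, hp, hq, hpq⟩ := a.2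
  obtain ⟨p', q', hp', hq', hpq'⟩ := b.2
  have hb : BddAbove (Set.range (Subtype.val : ({a, b} : Set (JordanMeasure M R)) → _)) := by
    refine ⟨⟨p + p', p + p', 0, hp.add hp', IsMeasure.zero, (sub_zero _).symm⟩, ?_⟩
    rw [Subtype.range_coe]
    rintro _ (rfl | rfl) <;> refine (le_iff _ _).2 fun x => ?_
    · rw [hpq]
      exact (sub_le_self _ (hq.nonneg x)).trans (le_add_of_nonneg_right (hp'.nonneg x))
    · rw [hpq']
      exact (sub_le_self _ (hq'.nonneg x)).trans (le_add_of_nonneg_left (hp.nonneg x))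
  obtain ⟨-, -, s, hs, -⟩ := exists_sup_formula hR _ hb
  rw [Subtype.range_coe] at hs
  exact ⟨s, hs⟩

theorem isLatticeOrderedGroup (hR : DedekindComplete R) :
    IsLatticeOrderedGroup (JordanMeasure M R) where
  add_le_add a b c d h := add_le_add_left (add_le_add_right h c) d
  exists_sup := exists_isLUB_pair hR
  exists_inf a b := by
    obtain ⟨c, hc⟩ := exists_isLUB_pair hR (-a) (-b)
    refine ⟨-c, isLUB_neg.1 ?_⟩
    rw [← Set.image_neg_eq_neg, Set.image_pair]
    exact hc

theorem dedekindComplete (hR : DedekindComplete R) : DedekindComplete (JordanMeasure M R) := by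
  intro S hne hb
  have := hne.to_subtype
  obtain ⟨-, -, s, hs, -⟩ := exists_sup_formula hR (Subtype.val : S → JordanMeasure M R)
    (by rwa [Subtype.range_coe])
  rw [Subtype.range_coe] at hs
  exact ⟨s, hs⟩

theorem isRieszSpace (hR : DedekindComplete R) : IsRieszSpace (JordanMeasure M R) where
  isLatticeOrderedGroup := isLatticeOrderedGroup hR
  smul_nonneg _ f ha hf := (nonneg_iff _).2 (((nonneg_iff f).1 hf).smul ha)

end JordanMeasure

end PseudoMV

theorem mainTheorem3 {M : Type u} [PseudoMVAlgebra M]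
    {R : Type v} [AddCommGroup R] [Lattice R] [IsOrderedAddMonoid R] [Module ℝ R]
    [IsOrderedModule ℝ R] (hR : PseudoMV.DedekindComplete R) :
    -- (a) a Dedekind complete lattice-ordered group
    (PseudoMV.IsLatticeOrderedGroup (PseudoMV.JordanMeasure M R) ∧
      PseudoMV.DedekindComplete (PseudoMV.JordanMeasure M R)) ∧
    -- (b) suprema of non-empty families bounded above
    (∀ (I : Type w) [Nonempty I] (m : I → PseudoMV.JordanMeasure M R),
      BddAbove (Set.range m) →
      ∃ d : M → R, (∀ x : M, IsLUB (Set.range fun i => m i x) (d x)) ∧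
        ∃ s : PseudoMV.JordanMeasure M R, IsLUB (Set.range m) s ∧
          ∀ x : M, IsLUB (PseudoMV.decompSums d x) (s x)) ∧
    -- (c) infima of non-empty families bounded below
    (∀ (I : Type w) [Nonempty I] (m : I → PseudoMV.JordanMeasure M R),
      BddBelow (Set.range m) →
      ∃ e : M → R, (∀ x : M, IsGLB (Set.range fun i => m i x) (e x)) ∧
        ∃ s : PseudoMV.JordanMeasure M R, IsGLB (Set.range m) s ∧
          ∀ x : M, IsGLB (PseudoMV.decompSums e x) (s x)) ∧
    -- (d) a Dedekind complete Riesz space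
    (PseudoMV.IsRieszSpace (PseudoMV.JordanMeasure M R) ∧
      PseudoMV.DedekindComplete (PseudoMV.JordanMeasure M R)) := by
  exact ⟨⟨PseudoMV.JordanMeasure.isLatticeOrderedGroup hR,
      PseudoMV.JordanMeasure.dedekindComplete hR⟩,
    fun _ _ m hm => PseudoMV.JordanMeasure.exists_sup_formula hR m hm,
    fun _ _ m hm => PseudoMV.JordanMeasure.exists_inf_formula hR m hm,
    PseudoMV.JordanMeasure.isRieszSpace hR, PseudoMV.JordanMeasure.dedekindComplete hR⟩
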